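/- **Setting.** $Ty_n$ is classical higher-order logic (Church–Henkin style simple type theory, axiomatized as Andrews' system $Q_0$) with truth type $t$, individual types $e_1,\dots,e_n$, function types $\alpha\beta$ (from $\alpha$ to $\beta$), product types $\alpha\times\beta$ with pairs and projections, arbitrary non-logical constants, and at every type $\alpha$ a description operator $\iota_{(\alpha t)\alpha}$ satisfying $\vdash\iota\,\lambda x_\alpha(y_\alpha=x_\alpha)=y_\alpha$. At a product type $\beta\times\gamma$, $\iota$ denotes below the operator $\lambda z\,\bigl(\iota\,\lambda x_\beta\exists x_\gamma\, z(x_\beta,x_\gamma),\ \iota\,\lambda x_\gamma\exists x_\beta\, z(x_\beta,x_\gamma)\bigr)$, recursively. Let $\mathcal A=\{a_1,\dots,a_N\}$ be a finite alphabet and write $s=e_n$. $Ty_n^{\mathcal A}$ is $Ty_n$ with constants $C^0_s,C^1_s,\dots,C^N_s$ and a binary operation $+$ on $s$ (a constant of type $sss$), and the axioms that $+$ is associative with two-sided unit $C^0_s$ and that $x+C^i_s+y\neq x+C^j_s+z$ for all $x,y,z$ of type $s$ and $1\le i<j\le N$. For a word $w\in\mathcal A^*$ let $/w/$ be the term $C^0_s$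 if $w$ is empty and $C^{i_1}_s+(\dots+C^{i_k}_s)$ if $w=a_{i_1}\cdots a_{i_k}$. $Ty_n^{\mathcal A+}$ is an extension of $Ty_n^{\mathcal A}$ by additional non-logical constants (without axioms), and $\vdash$ is provability in it; in $\Delta\vdash A$ the free variables of the hypotheses $\Delta$ are kept fixed. An $\alpha$-language $\mathcal L$ is a set of pairs $(w,A_\alpha)$ of a word and an $\alpha$-term of $Ty_n^{\mathcal A}$. A word $w$ is *valid* in $\mathcal L$ if $(w,A_\alpha)\in\mathcal L$ for some $A_\alpha$ (otherwise *invalid*), and *ambiguous* if $(w,B_\alpha),(w,C_\alpha)\in\mathcal L$ for some $B_\alpha,C_\alpha$ with $\nvdash B_\alpha=C_\alpha$. Let $\Delta$ be a set of $Ty_n^{\mathcal A+}$ formulas and $L_{s\alpha t}$ a $Ty_n^{\mathcal A+}$ term. $(\Delta,L_{s\alpha t})$ is a *pseudo-canonic representation* of $\mathcal L$ if 1. $\Delta$ is consistent and, for all $w\in\mathcal A^*$ and all $Ty_n^{\mathcal A}$ terms $A_\alpha$: $(w,A_\alpha)\in\mathcal L\iff\Delta\vdash L_{s\alpha t}\,/w/\,A_\alpha$;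 2. for every $w\in\mathcal A^*$ there are finitely many (possibly no) $Ty_n^{\mathcal A}$ terms $A^1_\alpha,\dots,A^l_\alpha$ with $\Delta\vdash L_{s\alpha t}\,/w/=\lambda x_\alpha(x_\alpha=A^1_\alpha\vee\dots\vee x_\alpha=A^l_\alpha)$, where the $x_\alpha$ is not free in the $A^i_\alpha$ and the empty disjunction is the false value; 3. $\Delta$ is conservative over $Ty_n^{\mathcal A}$: for every $Ty_n^{\mathcal A}$ formula $A_t$, $\vdash A_t\iff\Delta\vdash A_t$. The translation operator is $\tau=\lambda x_{s\alpha t}\lambda x_s\,\bigl(\iota_{(\alpha t)\alpha}(x_{s\alpha t}\,x_s)\bigr)$, and the self-extension of $L_{s\alpha t}$ is $$L^+_{s\alpha t}=\lambda x_s\lambda x_\alpha\bigl(L_{s\alpha t}\,x_s\,x_\alpha\ \vee\ x_\alpha=\tau\,L_{s\alpha t}\,x_s\bigr)$$ ($x_s,x_\alpha$ not free in $L_{s\alpha t}$). **Proposition 10.1.** Let $(\Delta,L_{s\alpha t})$ be a pseudo-canonic representation of an $\alpha$-language $\mathcal L$, and let $w\in\mathcal A^*$ be either a valid and non-ambiguous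 expression of $\mathcal L$ or an invalid one. Then $$\Delta\vdash \tau\,L^+_{s\alpha t}\,/w/=\tau\,L_{s\alpha t}\,/w/ .$$ -/

import Mathlib

namespace UHOG

universe u v

/-! ### Types -/

/-- Types of the sorted type theory `Ty_n`: the truth type `t`, the individual types `e_1, …, e_n`
(`ind i`, `i : Fin n`), functional types (from `α` to `β`) and product types. -/
inductive Ty (n : ℕ) : Type
  | t : Ty n
  | ind (i : Fin n) : Ty n
  | fn (α β : Ty n) : Ty n
  | prod (α β : Ty n) : Ty n

infixr:65 " ⇒ " => Ty.fn

/-- The symbolic type `s`, i.e. the last individual type `e_n`. -/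
abbrev Ty.sym {n : ℕ} [NeZero n] : Ty n :=
  Ty.ind ⟨n - 1, Nat.sub_one_lt (NeZero.ne n)⟩

/-! ### Terms

Free variables are named: `fvar α i` is the variable `x^i_α`.  Bound variables are well-typed
de Bruijn indices, so terms are identified up to renaming of bound variables.  `Term N K Γ α` are
the terms of type `α` whose dangling indices are listed in `Γ`; the terms of type `α` of the
theory are the elements of `Term N K [] α`. -/

/-- Non-logical constants of `Ty_n^𝒜` for an alphabet of `N` letters: the empty symbol `C^0_s`, the
letters `C^1_s, …, C^N_s`, the concatenation `C^0_{sss}` and other constants, given by `K`. -/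
inductive Const {n : ℕ} [NeZero n] (N : ℕ) (K : Ty n → Type u) : Ty n → Type u
  | eps : Const N K Ty.sym
  | letter (i : Fin N) : Const N K Ty.sym
  | concat : Const N K (Ty.sym ⇒ Ty.sym ⇒ Ty.sym)
  | other {α : Ty n} (c : K α) : Const N K α

/-- Well-typed de Bruijn indices. -/
inductive Var {n : ℕ} : List (Ty n) → Ty n → Type
  | zero {Γ : List (Ty n)} {α : Ty n} : Var (α :: Γ) α
  | succ {Γ : List (Ty n)} {α β : Ty n} (x : Var Γ α) : Var (β :: Γ) α

/-- Terms; `iota α` is the primitive description operator of type `(αt)α`. -/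
inductive Term {n : ℕ} [NeZero n] (N : ℕ) (K : Ty n → Type u) : List (Ty n) → Ty n → Type u
  | fvar {Γ : List (Ty n)} (α : Ty n) (i : ℕ) : Term N K Γ α
  | bvar {Γ : List (Ty n)} {α : Ty n} (x : Var Γ α) : Term N K Γ α
  | const {Γ : List (Ty n)} {α : Ty n} (c : Const N K α) : Term N K Γ α
  | iota {Γ : List (Ty n)} (α : Ty n) : Term N K Γ ((α ⇒ Ty.t) ⇒ α)
  | app {Γ : List (Ty n)} {α β : Ty n} (A : Term N K Γ (α ⇒ β)) (B : Term N K Γ α) : Term N K Γ β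
  | lam {Γ : List (Ty n)} {α β : Ty n} (A : Term N K (α :: Γ) β) : Term N K Γ (α ⇒ β)
  | eq {Γ : List (Ty n)} {α : Ty n} (A B : Term N K Γ α) : Term N K Γ Ty.t
  | pair {Γ : List (Ty n)} {α β : Ty n} (A : Term N K Γ α) (B : Term N K Γ β) :
      Term N K Γ (Ty.prod α β)
  | fst {Γ : List (Ty n)} {α β : Ty n} (A : Term N K Γ (Ty.prod α β)) : Term N K Γ α
  | snd {Γ : List (Ty n)} {α β : Ty n} (A : Term N K Γ (Ty.prod α β)) : Term N K Γ β

variable {n : ℕ}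

/-! ### Renaming and (capture-avoiding) substitution of de Bruijn indices -/

/-- Renamings. -/
abbrev Ren (Γ Γ' : List (Ty n)) : Type := ∀ α : Ty n, Var Γ α → Var Γ' α

/-- Extension of a renaming under a binder. -/
def Ren.lift {Γ Γ' : List (Ty n)} (r : Ren Γ Γ') (β : Ty n) : Ren (β :: Γ) (β :: Γ')
  | _, Var.zero => Var.zero
  | _, Var.succ x => Var.succ (r _ x)

variable [NeZero n] {N : ℕ} {K : Ty n → Type u} {K' : Ty n → Type v}

/-- Action of a renaming on a term. -/
def Term.rename {Γ : List (Ty n)} {α : Ty n} :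
    Term N K Γ α → ∀ {Γ' : List (Ty n)}, Ren Γ Γ' → Term N K Γ' α
  | .fvar α i, _, _ => .fvar α i
  | .bvar x, _, r => .bvar (r _ x)
  | .const c, _, _ => .const c
  | .iota α, _, _ => .iota α
  | .app A B, _, r => .app (A.rename r) (B.rename r)
  | .lam A, _, r => .lam (A.rename (r.lift _))
  | .eq A B, _, r => .eq (A.rename r) (B.rename r)
  | .pair A B, _, r => .pair (A.rename r) (B.rename r)
  | .fst A, _, r => .fst (A.rename r)
  | .snd A, _, r => .snd (A.rename r)

/-- Weakening: `A` seen under one more binder, which it does not use. -/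
def Term.shift {Γ : List (Ty n)} {α : Ty n} (β : Ty n) (A : Term N K Γ α) : Term N K (β :: Γ) α :=
  A.rename (fun _ x => Var.succ x)

/-- Simultaneous substitutions. -/
abbrev Sub (N : ℕ) (K : Ty n → Type u) (Γ Γ' : List (Ty n)) : Type u :=
  ∀ α : Ty n, Var Γ α → Term N K Γ' α

/-- Extension of a substitution under a binder. -/
def Sub.lift {Γ Γ' : List (Ty n)} (σ : Sub N K Γ Γ') (β : Ty n) : Sub N K (β :: Γ) (β :: Γ')
  | _, Var.zero => .bvar Var.zero
  | _, Var.succ x => (σ _ x).shift β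

/-- Action of a substitution on a term. -/
def Term.subst {Γ : List (Ty n)} {α : Ty n} :
    Term N K Γ α → ∀ {Γ' : List (Ty n)}, Sub N K Γ Γ' → Term N K Γ' α
  | .fvar α i, _, _ => .fvar α i
  | .bvar x, _, σ => σ _ x
  | .const c, _, _ => .const c
  | .iota α, _, _ => .iota α
  | .app A B, _, σ => .app (A.subst σ) (B.subst σ)
  | .lam A, _, σ => .lam (A.subst (σ.lift _))
  | .eq A B, _, σ => .eq (A.subst σ) (B.subst σ)
  | .pair A B, _, σ => .pair (A.subst σ) (B.subst σ)
  | .fst A, _, σ => .fst (A.subst σ)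
  | .snd A, _, σ => .snd (A.subst σ)

/-- The substitution replacing index `0` by `B`. -/
def Sub.single {Γ : List (Ty n)} {β : Ty n} (B : Term N K Γ β) : Sub N K (β :: Γ) Γ
  | _, Var.zero => B
  | _, Var.succ x => .bvar x

/-- `A.inst B` is the body `A` of an abstraction with its bound variable replaced by `B`. -/
def Term.inst {Γ : List (Ty n)} {α β : Ty n} (A : Term N K (β :: Γ) α) (B : Term N K Γ β) :
    Term N K Γ α :=
  A.subst (Sub.single B)

/-! ### Defined logical symbols (as in the equality-based systems of Henkin, Andrews, Gallin) -/

section Logic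

variable {Γ : List (Ty n)}

/-- The three innermost bound variables. -/
abbrev Term.v0 {α : Ty n} : Term N K (α :: Γ) α := .bvar Var.zero
/-- See `Term.v0`. -/
abbrev Term.v1 {α β : Ty n} : Term N K (β :: α :: Γ) α := .bvar (Var.succ Var.zero)
/-- See `Term.v0`. -/
abbrev Term.v2 {α β γ : Ty n} : Term N K (γ :: β :: α :: Γ) α :=
  .bvar (Var.succ (Var.succ Var.zero))

/-- The true value: `λx_t x_t = λx_t x_t`. -/
def Term.tru : Term N K Γ Ty.t :=
  .eq (.lam (.v0 : Term N K (Ty.t :: Γ) Ty.t)) (.lam .v0)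

/-- `∀x_α A`, i.e. `λx_α T = λx_α A`. -/
def Term.all {α : Ty n} (A : Term N K (α :: Γ) Ty.t) : Term N K Γ Ty.t :=
  .eq (.lam .tru) (.lam A)

/-- The false value: `∀x_t x_t`. -/
def Term.fls : Term N K Γ Ty.t :=
  .all (.v0 : Term N K (Ty.t :: Γ) Ty.t)

/-- `¬A`, i.e. `F = A`. -/
def Term.not (A : Term N K Γ Ty.t) : Term N K Γ Ty.t := .eq .fls A

/-- `A ∧ B`, i.e. `λg_{ttt} (g T T) = λg_{ttt} (g A B)`. -/
def Term.and (A B : Term N K Γ Ty.t) : Term N K Γ Ty.t :=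
  .eq
    (.lam (α := Ty.t ⇒ Ty.t ⇒ Ty.t) (.app (.app .v0 .tru) .tru))
    (.lam (α := Ty.t ⇒ Ty.t ⇒ Ty.t) (.app (.app .v0 (A.shift _)) (B.shift _)))

/-- `A → B`, i.e. `A = (A ∧ B)`. -/
def Term.imp (A B : Term N K Γ Ty.t) : Term N K Γ Ty.t := .eq A (.and A B)

/-- `A ∨ B`, i.e. `¬(¬A ∧ ¬B)`. -/
def Term.or (A B : Term N K Γ Ty.t) : Term N K Γ Ty.t := .not (.and (.not A) (.not B))

/-- `∃x_α A`, i.e. `¬∀x_α ¬A`. -/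
def Term.ex {α : Ty n} (A : Term N K (α :: Γ) Ty.t) : Term N K Γ Ty.t := .not (.all (.not A))

/-! ### The non-logical axioms of `Ty_n^𝒜` -/

/-- The empty symbol `C^0_s`. -/
abbrev Term.eps : Term N K Γ Ty.sym := .const .eps

/-- The letter `C^i_s`. -/
abbrev Term.letter (i : Fin N) : Term N K Γ Ty.sym := .const (.letter i)

/-- Concatenation `A + B` of terms of type `s`. -/
def Term.cat (A B : Term N K Γ Ty.sym) : Term N K Γ Ty.sym := .app (.app (.const .concat) A) B

/-- `∀x ((x + C^0 = x) ∧ (C^0 + x = x))`. -/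
def Term.axUnit : Term N K Γ Ty.t :=
  .all (α := Ty.sym) (.and (.eq (.cat .v0 .eps) .v0) (.eq (.cat .eps .v0) .v0))

/-- `∀x ∀y ∀z ((x + y) + z = x + (y + z))`. -/
def Term.axAssoc : Term N K Γ Ty.t :=
  .all (α := Ty.sym) (.all (α := Ty.sym) (.all (α := Ty.sym)
    (.eq (.cat (.cat .v2 .v1) .v0) (.cat .v2 (.cat .v1 .v0)))))

/-- `∀x ∀y ∀z (x + C^i + y ≠ x + C^j + z)`. -/
def Term.axLetter (i j : Fin N) : Term N K Γ Ty.t :=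
  .all (α := Ty.sym) (.all (α := Ty.sym) (.all (α := Ty.sym)
    (.not (.eq (.cat .v2 (.cat (.letter i) .v1)) (.cat .v2 (.cat (.letter j) .v0))))))

end Logic

/-! ### Provability -/

/-- `Prov H A` is `H ⊢ A` in `Ty_n^𝒜` with further constants `K`: the system `Q_0` of Andrews,
generalized to the individual types `e_1, …, e_n` and to product types, with the description
operator at every type, plus the axioms of the symbolic type.  `H` is a set of hypotheses, whose
free variables are kept fixed. Andrews' rule of replacement of a subterm by an equal one is given by
`mpEq` and the congruence rules; in `congLam` the newly bound variable is fresh for `H`. -/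
inductive Prov : {Γ : List (Ty n)} → Set (Term N K Γ Ty.t) → Term N K Γ Ty.t → Prop
  /- Hypotheses. -/
  | hyp {Γ : List (Ty n)} {H : Set (Term N K Γ Ty.t)} {A : Term N K Γ Ty.t} (h : A ∈ H) : Prov H A
  /- Rule of replacement. -/
  | mpEq {Γ : List (Ty n)} {H : Set (Term N K Γ Ty.t)} {A B : Term N K Γ Ty.t}
      (h : Prov H (.eq A B)) (hA : Prov H A) : Prov H B
  | refl {Γ : List (Ty n)} {H : Set (Term N K Γ Ty.t)} {α : Ty n} (A : Term N K Γ α) :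
      Prov H (.eq A A)
  | congApp {Γ : List (Ty n)} {H : Set (Term N K Γ Ty.t)} {α β : Ty n}
      {A A' : Term N K Γ (α ⇒ β)} {B B' : Term N K Γ α}
      (hA : Prov H (.eq A A')) (hB : Prov H (.eq B B')) : Prov H (.eq (.app A B) (.app A' B'))
  | congLam {Γ : List (Ty n)} {H : Set (Term N K Γ Ty.t)} {α β : Ty n}
      {A A' : Term N K (α :: Γ) β} (h : Prov (Term.shift α '' H) (.eq A A')) :
      Prov H (.eq (.lam A) (.lam A'))
  | congEq {Γ : List (Ty n)} {H : Set (Term N K Γ Ty.t)} {α : Ty n} {A A' B B' : Term N K Γ α}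
      (hA : Prov H (.eq A A')) (hB : Prov H (.eq B B')) : Prov H (.eq (.eq A B) (.eq A' B'))
  | congPair {Γ : List (Ty n)} {H : Set (Term N K Γ Ty.t)} {α β : Ty n}
      {A A' : Term N K Γ α} {B B' : Term N K Γ β}
      (hA : Prov H (.eq A A')) (hB : Prov H (.eq B B')) : Prov H (.eq (.pair A B) (.pair A' B'))
  | congFst {Γ : List (Ty n)} {H : Set (Term N K Γ Ty.t)} {α β : Ty n}
      {A A' : Term N K Γ (Ty.prod α β)} (h : Prov H (.eq A A')) : Prov H (.eq (.fst A) (.fst A'))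
  | congSnd {Γ : List (Ty n)} {H : Set (Term N K Γ Ty.t)} {α β : Ty n}
      {A A' : Term N K Γ (Ty.prod α β)} (h : Prov H (.eq A A')) : Prov H (.eq (.snd A) (.snd A'))
  /- Two truth values: `(g T ∧ g F) = ∀x_t (g x)`. -/
  | bool {Γ : List (Ty n)} {H : Set (Term N K Γ Ty.t)} (G : Term N K Γ (Ty.t ⇒ Ty.t)) :
      Prov H (.eq (.and (.app G .tru) (.app G .fls)) (.all (.app (G.shift Ty.t) .v0)))
  /- Equals have the same properties: `A = B → (P A = P B)`. -/
  | leibniz {Γ : List (Ty n)} {H : Set (Term N K Γ Ty.t)} {α : Ty n} (A B : Term N K Γ α)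
      (P : Term N K Γ (α ⇒ Ty.t)) :
      Prov H (.imp (.eq A B) (.eq (.app P A) (.app P B)))
  /- Extensionality: `(F = G) = ∀x (F x = G x)`. -/
  | ext {Γ : List (Ty n)} {H : Set (Term N K Γ Ty.t)} {α β : Ty n} (F G : Term N K Γ (α ⇒ β)) :
      Prov H (.eq (.eq F G) (.all (.eq (.app (F.shift α) .v0) (.app (G.shift α) .v0))))
  /- Conversion: `(λx A) B = A(B)`. -/
  | beta {Γ : List (Ty n)} {H : Set (Term N K Γ Ty.t)} {α β : Ty n} (A : Term N K (α :: Γ) β)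
      (B : Term N K Γ α) : Prov H (.eq (.app (.lam A) B) (A.inst B))
  /- Description: `ι λx (A = x) = A`. -/
  | descr {Γ : List (Ty n)} {H : Set (Term N K Γ Ty.t)} {α : Ty n} (A : Term N K Γ α) :
      Prov H (.eq (.app (.iota α) (.lam (.eq (A.shift α) .v0))) A)
  /- Pairs. -/
  | fstPair {Γ : List (Ty n)} {H : Set (Term N K Γ Ty.t)} {α β : Ty n} (A : Term N K Γ α)
      (B : Term N K Γ β) : Prov H (.eq (.fst (.pair A B)) A)
  | sndPair {Γ : List (Ty n)} {H : Set (Term N K Γ Ty.t)} {α β : Ty n} (A : Term N K Γ α)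
      (B : Term N K Γ β) : Prov H (.eq (.snd (.pair A B)) B)
  | pairEta {Γ : List (Ty n)} {H : Set (Term N K Γ Ty.t)} {α β : Ty n}
      (A : Term N K Γ (Ty.prod α β)) : Prov H (.eq (.pair (.fst A) (.snd A)) A)
  /- The symbolic type. -/
  | unit {Γ : List (Ty n)} {H : Set (Term N K Γ Ty.t)} : Prov H .axUnit
  | assoc {Γ : List (Ty n)} {H : Set (Term N K Γ Ty.t)} : Prov H .axAssoc
  | letter {Γ : List (Ty n)} {H : Set (Term N K Γ Ty.t)} (i j : Fin N) (hij : i < j) :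
      Prov H (.axLetter i j)

/-- A set of formulas is consistent if it does not prove the false value. -/
def Consistent (H : Set (Term N K [] Ty.t)) : Prop := ¬ Prov H .fls

/-! ### Predicates, words, translation -/

section Operators

variable {Γ : List (Ty n)}

/-- The predicate `(= A)`, i.e. `λx_α (x_α = A)`. -/
def Term.eqTo {α : Ty n} (A : Term N K Γ α) : Term N K Γ (α ⇒ Ty.t) :=
  .lam (.eq .v0 (A.shift α))

/-- Disjunction of predicates, `λx_α (P x_α ∨ Q x_α)`. -/
def Term.orPred {α : Ty n} (P Q : Term N K Γ (α ⇒ Ty.t)) : Term N K Γ (α ⇒ Ty.t) :=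
  .lam (.or (.app (P.shift α) .v0) (.app (Q.shift α) .v0))

/-- Disjunction of binary predicates, `λx_β (P x_β ∨ Q x_β)`. -/
def Term.orRel {α β : Ty n} (P Q : Term N K Γ (β ⇒ α ⇒ Ty.t)) : Term N K Γ (β ⇒ α ⇒ Ty.t) :=
  .lam (.orPred (.app (P.shift β) .v0) (.app (Q.shift β) .v0))

/-- Disjunction of a finite list of predicates; the empty one is `λx_α F`. -/
def Term.bigOr {α : Ty n} : List (Term N K Γ (α ⇒ Ty.t)) → Term N K Γ (α ⇒ Ty.t)
  | [] => .lam .fls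
  | [P] => P
  | P :: Q :: l => .orPred P (Term.bigOr (Q :: l))

/-- The term `T_A(w)`, also written `/w/`, that denotes the word `w`. -/
def Term.word : List (Fin N) → Term N K Γ Ty.sym
  | [] => .eps
  | [a] => .letter a
  | a :: b :: l => .cat (.letter a) (Term.word (b :: l))

/-- The description operator of type `(αt)α`.  At a product type `β × γ` it is
`λz (ι λx_β ∃x_γ z (x_β, x_γ), ι λx_γ ∃x_β z (x_β, x_γ))`, recursively; at other types it is
the primitive one. -/
def Term.desc {Γ : List (Ty n)} : (α : Ty n) → Term N K Γ ((α ⇒ Ty.t) ⇒ α)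
  | .prod β γ =>
      .lam (.pair
        (.app (Term.desc β) (.lam (.ex (α := γ) (.app .v2 (.pair .v1 .v0)))))
        (.app (Term.desc γ) (.lam (.ex (α := β) (.app .v2 (.pair .v0 .v1))))))
  | .t => .iota _
  | .ind _ => .iota _
  | .fn _ _ => .iota _

/-- The translation operator `τ`, i.e. `λx_{sαt} λx_s (ι (x_{sαt} x_s))`. -/
def Term.trans (α : Ty n) : Term N K Γ ((Ty.sym ⇒ α ⇒ Ty.t) ⇒ Ty.sym ⇒ α) :=
  .lam (.lam (.app (Term.desc α) (.app .v1 .v0)))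

/-- The self-extension `L⁺`, i.e. `L ∨ λx_s (= τ L x_s)`. -/
def Term.selfExt {α : Ty n} (L : Term N K Γ (Ty.sym ⇒ α ⇒ Ty.t)) :
    Term N K Γ (Ty.sym ⇒ α ⇒ Ty.t) :=
  .orRel L (.lam (.eqTo (.app (.app (Term.trans α) (L.shift Ty.sym)) .v0)))

end Operators

/-! ### Languages and their representations

`K` are the constants of `Ty_n^𝒜` (besides the symbolic ones) and `K'` those added in `Ty_n^{𝒜+}`.
As the added constants have no axioms, provability of a `Ty_n^𝒜` formula may be, and is, taken in
`Ty_n^{𝒜+}`. -/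

/-- The constants of the extension `Ty_n^{𝒜+}`. -/
abbrev Plus (K : Ty n → Type u) (K' : Ty n → Type v) : Ty n → Type (max u v) :=
  fun α => K α ⊕ K' α

/-- A `Ty_n^𝒜` constant as a `Ty_n^{𝒜+}` constant. -/
def Const.incl (K' : Ty n → Type v) {α : Ty n} : Const N K α → Const N (Plus K K') α
  | .eps => .eps
  | .letter i => .letter i
  | .concat => .concat
  | .other c => .other (Sum.inl c)

/-- A `Ty_n^𝒜` term as a `Ty_n^{𝒜+}` term. -/
def Term.incl (K' : Ty n → Type v) {Γ : List (Ty n)} {α : Ty n} :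
    Term N K Γ α → Term N (Plus K K') Γ α
  | .fvar α i => .fvar α i
  | .bvar x => .bvar x
  | .const c => .const (c.incl K')
  | .iota α => .iota α
  | .app A B => .app (A.incl K') (B.incl K')
  | .lam A => .lam (A.incl K')
  | .eq A B => .eq (A.incl K') (B.incl K')
  | .pair A B => .pair (A.incl K') (B.incl K')
  | .fst A => .fst (A.incl K')
  | .snd A => .snd (A.incl K')

/-- An `α`-language: a relation between words over the alphabet and `α`-terms. -/
abbrev Lang (N : ℕ) (K : Ty n → Type u) (α : Ty n) : Type u :=
  Set (List (Fin N) × Term N K [] α)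

/-- `w` is a valid expression of the language: it has a meaning. -/
def Lang.Valid {α : Ty n} (𝓛 : Lang N K α) (w : List (Fin N)) : Prop :=
  ∃ A, (w, A) ∈ 𝓛

/-- `w` is ambiguous: it has two meanings that are not provably equal. -/
def Lang.Ambiguous (K' : Ty n → Type v) {α : Ty n} (𝓛 : Lang N K α)
    (w : List (Fin N)) : Prop :=
  ∃ B C, (w, B) ∈ 𝓛 ∧ (w, C) ∈ 𝓛 ∧
    ¬ Prov (∅ : Set (Term N (Plus K K') [] Ty.t)) (.eq (B.incl K') (C.incl K'))

/-- `(Δ, L)` represents the language `𝓛`. -/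
structure Represents {α : Ty n} (Δ : Set (Term N (Plus K K') [] Ty.t))
    (L : Term N (Plus K K') [] (Ty.sym ⇒ α ⇒ Ty.t)) (𝓛 : Lang N K α) : Prop where
  consistent : Consistent Δ
  mem_iff : ∀ (w : List (Fin N)) (A : Term N K [] α),
    (w, A) ∈ 𝓛 ↔ Prov Δ (.app (.app L (.word w)) (A.incl K'))

/-- `(Δ, L)` is a pseudo-canonic representation of the language `𝓛`. -/
structure PseudoCanonic {α : Ty n} (Δ : Set (Term N (Plus K K') [] Ty.t))
    (L : Term N (Plus K K') [] (Ty.sym ⇒ α ⇒ Ty.t)) (𝓛 : Lang N K α) : Prop where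
  represents : Represents Δ L 𝓛
  finite : ∀ w : List (Fin N), ∃ As : List (Term N K [] α),
    Prov Δ (.eq (.app L (.word w)) (.bigOr (As.map fun A => (A.incl K').eqTo)))
  conservative : ∀ φ : Term N K [] Ty.t,
    Prov (∅ : Set (Term N (Plus K K') [] Ty.t)) (φ.incl K') ↔ Prov Δ (φ.incl K')

end UHOG

open UHOG

namespace UHOG

universe u

variable {n : ℕ}

/-! By β, `L⁺ /w/` is the predicate `L /w/` with the single value `τ L /w/` adjoined
(`selfExt_app`), and a description operator returns the value of a singleton predicate
(`desc_eqTo`). If the finite disjunction representing `L /w/` is empty, only the adjoined value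
remains, so describing it returns `τ L /w/` whatever that denotes (`fls_orPred`). Otherwise each
listed term is a meaning of `w`, because the disjunction holds of it (`bigOr_app_of_mem`). Then `w`
is valid, hence non-ambiguous, the listed terms are provably equal, and `L /w/` collapses to some
`(= A)` (`bigOr_eq`). So `τ L /w/` equals `A`, and adjoining it changes nothing (`orPred_self`).

Most of the work is to obtain enough logic from an equational calculus. Description at product types
involves existential quantifiers, and these are handled by natural deduction, which rests on the
deduction theorem (`deduction`) and propositional extensionality (`prop_ext`). -/

theorem Ren.lift_comp {Γ Γ' Γ'' : List (Ty n)} (r : Ren Γ Γ') (s : Ren Γ' Γ'')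
    (β : Ty n) :
    (fun α x => s.lift β α (r.lift β α x)) = Ren.lift (fun α x => s α (r α x)) β := by
  funext α x
  cases x <;> rfl

variable [NeZero n] {N : ℕ} {K : Ty n → Type u}

/-! ### Substitution calculus -/

section Substitution

variable {Γ Γ' Γ'' : List (Ty n)} {α β : Ty n}

theorem Term.rename_rename (A : Term N K Γ α) (r : Ren Γ Γ') (s : Ren Γ' Γ'') :
    (A.rename r).rename s = A.rename (fun α x => s α (r α x)) := by
  induction A generalizing Γ' Γ'' <;> simp_all [Term.rename, Ren.lift_comp]

theorem Sub.lift_rename (r : Ren Γ Γ') (σ : Sub N K Γ' Γ'') (β : Ty n) :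
    (fun α x => σ.lift β α (r.lift β α x)) = Sub.lift (fun α x => σ α (r α x)) β := by
  funext α x
  cases x <;> rfl

theorem Term.subst_rename (A : Term N K Γ α) (r : Ren Γ Γ') (σ : Sub N K Γ' Γ'') :
    (A.rename r).subst σ = A.subst (fun α x => σ α (r α x)) := by
  induction A generalizing Γ' Γ'' <;> simp_all [Term.rename, Term.subst, Sub.lift_rename]

theorem Sub.rename_lift (σ : Sub N K Γ Γ') (r : Ren Γ' Γ'') (β : Ty n) :
    (fun α x => (σ.lift β α x).rename (r.lift β)) =
      Sub.lift (fun α x => (σ α x).rename r) β := by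
  funext α x
  cases x
  · rfl
  · simp [Sub.lift, Term.shift, Term.rename_rename, Ren.lift]

theorem Term.rename_subst (A : Term N K Γ α) (σ : Sub N K Γ Γ') (r : Ren Γ' Γ'') :
    (A.subst σ).rename r = A.subst (fun α x => (σ α x).rename r) := by
  induction A generalizing Γ' Γ'' <;> simp_all [Term.rename, Term.subst, Sub.rename_lift]

theorem Sub.lift_bvar (β : Ty n) :
    Sub.lift (fun _ x => .bvar x : Sub N K Γ Γ) β = fun _ x => .bvar x := by
  funext α x
  cases x <;> rfl

@[simp]
theorem Term.subst_bvar (A : Term N K Γ α) : A.subst (fun _ x => .bvar x) = A := by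
  induction A <;> simp_all [Term.subst, Sub.lift_bvar]

theorem Term.rename_eq_subst (A : Term N K Γ α) (r : Ren Γ Γ') :
    A.rename r = A.subst (fun _ x => .bvar (r _ x)) := by
  rw [← Term.subst_rename A r (fun _ x => .bvar x), Term.subst_bvar]

@[simp]
theorem Term.shift_subst_lift (A : Term N K Γ α) (σ : Sub N K Γ Γ') (β : Ty n) :
    (A.shift β).subst (σ.lift β) = (A.subst σ).shift β := by
  simp only [Term.shift, Term.subst_rename, Term.rename_subst]
  rfl

@[simp]
theorem Term.shift_subst_single (A : Term N K Γ α) (B : Term N K Γ β) :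
    (A.shift β).subst (Sub.single B) = A := by
  rw [Term.shift, Term.subst_rename]
  exact A.subst_bvar

@[simp]
theorem Sub.lift_zero (σ : Sub N K Γ Γ') (β : Ty n) :
    σ.lift β β Var.zero = .bvar Var.zero := rfl

@[simp]
theorem Sub.lift_succ (σ : Sub N K Γ Γ') (x : Var Γ α) (β : Ty n) :
    σ.lift β α (Var.succ x) = (σ α x).shift β := rfl

@[simp]
theorem Sub.single_zero (B : Term N K Γ β) : Sub.single B β Var.zero = B := rfl

@[simp]
theorem Sub.single_succ (B : Term N K Γ β) (x : Var Γ α) :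
    Sub.single B α (Var.succ x) = .bvar x := rfl

@[simp]
-- Weakening below a binder is undone by instantiating the unused index. This serves contexts whose
-- hole lies outside a quantifier over `A`.
theorem Term.rename_lift_subst_lift_single {γ : Ty n} (A : Term N K (γ :: Γ) α)
    (B : Term N K Γ β) :
    (A.rename (Ren.lift (fun _ x => Var.succ x) γ)).subst ((Sub.single B).lift γ) = A := by
  rw [Term.subst_rename, Sub.lift_rename]
  exact (congrArg A.subst (Sub.lift_bvar γ)).trans A.subst_bvar

@[simp]
-- The contraction met when a weakened abstraction is applied to the new variable, as in the
-- extensionality axiom.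
theorem Term.rename_lift_subst_single (A : Term N K (β :: Γ) α) :
    (A.rename (Ren.lift (fun _ x => Var.succ x) β)).subst (Sub.single (.bvar Var.zero)) = A := by
  rw [Term.subst_rename]
  convert A.subst_bvar using 2
  funext γ x
  cases x <;> rfl

attribute [simp] Term.subst

@[simp]
theorem Term.shift_bvar (x : Var Γ α) (β : Ty n) :
    (.bvar x : Term N K Γ α).shift β = .bvar (Var.succ x) := rfl

@[simp]
theorem Term.shift_lam {γ : Ty n} (A : Term N K (γ :: Γ) α) (β : Ty n) :
    (Term.lam A).shift β = .lam (A.rename (Ren.lift (fun _ x => Var.succ x) γ)) := rfl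

@[simp]
theorem Term.shift_fls (γ : Ty n) : (Term.fls : Term N K Γ Ty.t).shift γ = .fls := rfl

@[simp]
theorem Term.shift_tru (γ : Ty n) : (Term.tru : Term N K Γ Ty.t).shift γ = .tru := rfl

@[simp]
theorem Term.shift_not (A : Term N K Γ Ty.t) (γ : Ty n) :
    A.not.shift γ = (A.shift γ).not := rfl

@[simp]
theorem Term.subst_tru (σ : Sub N K Γ Γ') : (Term.tru : Term N K Γ Ty.t).subst σ = .tru := rfl

@[simp]
theorem Term.subst_fls (σ : Sub N K Γ Γ') : (Term.fls : Term N K Γ Ty.t).subst σ = .fls := rfl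

@[simp]
theorem Term.subst_all (A : Term N K (β :: Γ) Ty.t) (σ : Sub N K Γ Γ') :
    A.all.subst σ = (A.subst (σ.lift β)).all := rfl

@[simp]
theorem Term.subst_not (A : Term N K Γ Ty.t) (σ : Sub N K Γ Γ') :
    A.not.subst σ = (A.subst σ).not := rfl

@[simp]
theorem Term.subst_ex (A : Term N K (β :: Γ) Ty.t) (σ : Sub N K Γ Γ') :
    A.ex.subst σ = (A.subst (σ.lift β)).ex := rfl

@[simp]
theorem Term.subst_and (A B : Term N K Γ Ty.t) (σ : Sub N K Γ Γ') :
    (A.and B).subst σ = (A.subst σ).and (B.subst σ) := by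
  simp [Term.and]

@[simp]
theorem Term.subst_imp (A B : Term N K Γ Ty.t) (σ : Sub N K Γ Γ') :
    (A.imp B).subst σ = (A.subst σ).imp (B.subst σ) := by
  simp [Term.imp]

@[simp]
theorem Term.subst_or (A B : Term N K Γ Ty.t) (σ : Sub N K Γ Γ') :
    (A.or B).subst σ = (A.subst σ).or (B.subst σ) := by
  simp [Term.or]

@[simp]
theorem Term.subst_eqTo (A : Term N K Γ α) (σ : Sub N K Γ Γ') :
    A.eqTo.subst σ = (A.subst σ).eqTo := by
  simp [Term.eqTo]

@[simp]
theorem Term.subst_orPred (P Q : Term N K Γ (α ⇒ Ty.t)) (σ : Sub N K Γ Γ') :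
    (P.orPred Q).subst σ = (P.subst σ).orPred (Q.subst σ) := by
  simp [Term.orPred]

@[simp]
theorem Term.subst_desc (α : Ty n) (σ : Sub N K Γ Γ') : (Term.desc α).subst σ = .desc α := by
  induction α generalizing Γ Γ' <;> simp_all [Term.desc]

@[simp]
theorem Term.subst_trans (α : Ty n) (σ : Sub N K Γ Γ') : (Term.trans α).subst σ = .trans α := by
  simp [Term.trans]

end Substitution

/-! ### Equational reasoning -/

namespace Prov

variable {Γ : List (Ty n)} {H : Set (Term N K Γ Ty.t)} {α β : Ty n}

theorem symm {A B : Term N K Γ α} (h : Prov H (.eq A B)) : Prov H (.eq B A) :=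
  mpEq (congEq h (refl A)) (refl A)

theorem trans {A B C : Term N K Γ α} (h : Prov H (.eq A B)) (h' : Prov H (.eq B C)) :
    Prov H (.eq A C) :=
  mpEq (congEq (refl A) h') h

theorem mpEq' {A B : Term N K Γ Ty.t} (h : Prov H (.eq A B)) (hB : Prov H B) : Prov H A :=
  mpEq h.symm hB

theorem beta' (A : Term N K (α :: Γ) β) (B : Term N K Γ α) {C : Term N K Γ β}
    (h : A.inst B = C) : Prov H (.eq (.app (.lam A) B) C) :=
  h ▸ beta A B

/-- Equal terms may be substituted into a term. -/
theorem congInst (C : Term N K (α :: Γ) β) {A B : Term N K Γ α} (h : Prov H (.eq A B)) :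
    Prov H (.eq (C.inst A) (C.inst B)) :=
  (beta C A).symm.trans ((congApp (refl _) h).trans (beta C B))

theorem mono {Γ : List (Ty n)} {H H' : Set (Term N K Γ Ty.t)} {A : Term N K Γ Ty.t}
    (h : Prov H A) (hH : H ⊆ H') : Prov H' A := by
  induction h with
  | hyp h => exact hyp (hH h)
  | mpEq _ _ ih₁ ih₂ => exact mpEq (ih₁ hH) (ih₂ hH)
  | refl A => exact refl A
  | congApp _ _ ih₁ ih₂ => exact congApp (ih₁ hH) (ih₂ hH)
  | congLam _ ih => exact congLam (ih (Set.image_mono hH))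
  | congEq _ _ ih₁ ih₂ => exact congEq (ih₁ hH) (ih₂ hH)
  | congPair _ _ ih₁ ih₂ => exact congPair (ih₁ hH) (ih₂ hH)
  | congFst _ ih => exact congFst (ih hH)
  | congSnd _ ih => exact congSnd (ih hH)
  | bool G => exact bool G
  | leibniz A B P => exact leibniz A B P
  | ext F G => exact ext F G
  | beta A B => exact beta A B
  | descr A => exact descr A
  | fstPair A B => exact fstPair A B
  | sndPair A B => exact sndPair A B
  | pairEta A => exact pairEta A
  | unit => exact unit
  | assoc => exact assoc
  | letter i j hij => exact letter i j hij

/-- Conjunction hides its arguments under the binder of `g`. Replacing them one at a time through a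
term with a hole avoids carrying the given equations under that binder. -/
theorem congAnd {A A' B B' : Term N K Γ Ty.t} (hA : Prov H (.eq A A'))
    (hB : Prov H (.eq B B')) : Prov H (.eq (A.and B) (A'.and B')) := by
  have h₁ := congInst (.and .v0 (B.shift Ty.t)) hA
  have h₂ := congInst (.and (A'.shift Ty.t) .v0) hB
  simp only [Term.inst, Term.subst_and, Term.subst, Sub.single_zero,
    Term.shift_subst_single] at h₁ h₂
  exact h₁.trans h₂

theorem congImp {A A' B B' : Term N K Γ Ty.t} (hA : Prov H (.eq A A'))
    (hB : Prov H (.eq B B')) : Prov H (.eq (A.imp B) (A'.imp B')) :=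
  congEq hA (congAnd hA hB)

theorem congNot {A A' : Term N K Γ Ty.t} (hA : Prov H (.eq A A')) :
    Prov H (.eq A.not A'.not) :=
  congEq (refl _) hA

theorem congOr {A A' B B' : Term N K Γ Ty.t} (hA : Prov H (.eq A A'))
    (hB : Prov H (.eq B B')) : Prov H (.eq (A.or B) (A'.or B')) :=
  congNot (congAnd (congNot hA) (congNot hB))

theorem congAll {A A' : Term N K (α :: Γ) Ty.t}
    (h : Prov (Term.shift α '' H) (.eq A A')) : Prov H (.eq A.all A'.all) :=
  congEq (refl _) (congLam h)

theorem congEx {A A' : Term N K (α :: Γ) Ty.t}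
    (h : Prov (Term.shift α '' H) (.eq A A')) : Prov H (.eq A.ex A'.ex) :=
  congNot (congAll (congNot h))

theorem congOrPred {P P' Q Q' : Term N K Γ (α ⇒ Ty.t)} (hP : Prov H (.eq P P'))
    (hQ : Prov H (.eq Q Q')) : Prov H (.eq (P.orPred Q) (P'.orPred Q')) := by
  have h₁ := congInst (.orPred .v0 (Q.shift _)) hP
  have h₂ := congInst (.orPred (P'.shift _) .v0) hQ
  simp only [Term.inst, Term.subst_orPred, Term.subst, Sub.single_zero,
    Term.shift_subst_single] at h₁ h₂
  exact h₁.trans h₂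

theorem congEqTo {A B : Term N K Γ α} (h : Prov H (.eq A B)) :
    Prov H (.eq A.eqTo B.eqTo) := by
  simpa [Term.inst] using congInst (.eqTo .v0) h

/-! ### Truth values -/

theorem tru : Prov H .tru := refl _

theorem ext_lam (A A' : Term N K (α :: Γ) β) :
    Prov H (.eq (.eq (.lam A) (.lam A')) (.all (.eq A A'))) :=
  (ext _ _).trans (congAll (congEq (beta' _ _ (by simp [Term.inst]))
    (beta' _ _ (by simp [Term.inst]))))

theorem all_inst_eq {A : Term N K (α :: Γ) Ty.t} (h : Prov H A.all) (B : Term N K Γ α) :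
    Prov H (.eq .tru (A.inst B)) :=
  (beta' .tru B rfl).symm.trans ((congApp h (refl B)).trans (beta A B))

theorem all_elim {A : Term N K (α :: Γ) Ty.t} (h : Prov H A.all) (B : Term N K Γ α) :
    Prov H (A.inst B) :=
  mpEq (all_inst_eq h B) tru

/-- Extensionality turns reflexivity of the identity function into `∀x (x = x)`, which is then
instantiated. -/
theorem tru_eq_refl (A : Term N K Γ α) : Prov H (.eq .tru (.eq A A)) := by
  have h : Prov H (.all (.eq .v0 .v0 : Term N K (α :: Γ) Ty.t)) :=
    mpEq (ext_lam .v0 .v0) (refl _)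
  simpa [Term.inst] using all_inst_eq h A

theorem tru_eq_eq {A B : Term N K Γ α} (h : Prov H (.eq A B)) :
    Prov H (.eq .tru (.eq A B)) :=
  (tru_eq_refl A).trans (congEq (refl A) h)

theorem tru_and_tru : Prov H (.eq (.and .tru .tru) .tru) :=
  (tru_eq_refl _).symm

/-- At this stage only equations are known to equal `T`, so conjunction introduction is limited to
them. This already allows case analysis on equations. -/
theorem eq_and_eq {A B : Term N K Γ α} {C D : Term N K Γ β} (h : Prov H (.eq A B))
    (h' : Prov H (.eq C D)) : Prov H (.and (.eq A B) (.eq C D)) :=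
  mpEq ((congAnd (tru_eq_eq h).symm (tru_eq_eq h').symm).trans tru_and_tru).symm tru

theorem bool_lam (C : Term N K (Ty.t :: Γ) Ty.t) :
    Prov H (.eq (.and (C.inst .tru) (C.inst .fls)) C.all) :=
  (congAnd (beta _ _).symm (beta _ _).symm).trans ((bool _).trans
    (congAll (beta' _ _ (by simp [Term.inst]))))

/-- The two-values axiom for the identity predicate: its right side `∀x x` is the definition of `F`.
-/
theorem tru_and_fls : Prov H (.eq (.and .tru .fls) .fls) :=
  bool_lam .v0

/-- Proof by cases of an equation. -/
theorem cases_eq (A B : Term N K (Ty.t :: Γ) α) (hT : Prov H (.eq (A.inst .tru) (B.inst .tru)))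
    (hF : Prov H (.eq (A.inst .fls) (B.inst .fls))) (φ : Term N K Γ Ty.t) :
    Prov H (.eq (A.inst φ) (B.inst φ)) :=
  all_elim (mpEq (bool_lam (.eq A B)) (eq_and_eq hT hF)) φ

theorem tru_and (A : Term N K Γ Ty.t) : Prov H (.eq (.and .tru A) A) := by
  simpa [Term.inst] using cases_eq (H := H) (.and .tru .v0) .v0
    (by simpa [Term.inst] using tru_and_tru) (by simpa [Term.inst] using tru_and_fls) A

/-- The two-values axiom for `T = x` has right side `∀x (T = x)`. By extensionality this is `λx T =
λx x`, which is `F` by definition. -/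
theorem tru_eq_fls : Prov H (.eq (.eq .tru .fls) .fls) := by
  have h := bool_lam (H := H) (.eq .tru .v0)
  simp only [Term.inst, Term.subst, Term.subst_tru, Sub.single_zero] at h
  exact (tru_and _).symm.trans ((congAnd (tru_eq_refl _) (refl _)).trans
    (h.trans (ext_lam _ _).symm))

/-- Lets any theorem be replaced by `T`, which frees conjunction introduction and case analysis from
the restriction to equations. -/
theorem tru_eq (A : Term N K Γ Ty.t) : Prov H (.eq (.eq .tru A) A) := by
  simpa [Term.inst] using cases_eq (H := H) (.eq .tru .v0) .v0
    (by simpa [Term.inst] using (tru_eq_refl _).symm) (by simpa [Term.inst] using tru_eq_fls) A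

theorem eq_tru {A : Term N K Γ Ty.t} (h : Prov H A) : Prov H (.eq A .tru) :=
  (mpEq (tru_eq A).symm h).symm

theorem of_eq_tru {A : Term N K Γ Ty.t} (h : Prov H (.eq A .tru)) : Prov H A :=
  mpEq h.symm tru

theorem and_intro {A B : Term N K Γ Ty.t} (hA : Prov H A) (hB : Prov H B) :
    Prov H (A.and B) :=
  of_eq_tru ((congAnd (eq_tru hA) (eq_tru hB)).trans tru_and_tru)

theorem all_intro {A : Term N K (α :: Γ) Ty.t} (h : Prov (Term.shift α '' H) A) :
    Prov H A.all :=
  congLam (eq_tru h).symm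

/-- Proof by cases. -/
theorem cases (C : Term N K (Ty.t :: Γ) Ty.t) (hT : Prov H (C.inst .tru))
    (hF : Prov H (C.inst .fls)) (φ : Term N K Γ Ty.t) : Prov H (C.inst φ) :=
  all_elim (mpEq (bool_lam C) (and_intro hT hF)) φ

theorem tru_imp (A : Term N K Γ Ty.t) : Prov H (.eq (.imp .tru A) A) :=
  (congEq (refl _) (tru_and A)).trans (tru_eq A)

theorem mp {A B : Term N K Γ Ty.t} (h : Prov H (A.imp B)) (hA : Prov H A) : Prov H B :=
  mpEq ((congImp (eq_tru hA) (refl B)).trans (tru_imp B)) h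

theorem leibniz_inst (C : Term N K (α :: Γ) Ty.t) (A B : Term N K Γ α) :
    Prov H (.imp (.eq A B) (.eq (C.inst A) (C.inst B))) :=
  mpEq (congImp (refl _) (congEq (beta _ _) (beta _ _))) (leibniz A B (.lam C))

/-- `F` is itself the equation `λx T = λx x`. Leibniz' axiom for evaluation at `A` derives `T = A`
from it. -/
theorem fls_imp (A : Term N K Γ Ty.t) : Prov H (.imp .fls A) := by
  have h := leibniz_inst (H := H) (α := Ty.t ⇒ Ty.t) (.app .v0 (A.shift _))
    (.lam .tru) (.lam .v0)
  simp only [Term.inst, Term.subst, Term.shift_subst_single, Sub.single_zero] at h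
  exact mpEq (congImp (refl _) ((congEq (beta' _ _ rfl) (beta' _ A rfl)).trans (tru_eq A))) h

theorem fls_imp_eq (A : Term N K Γ Ty.t) : Prov H (.eq (.imp .fls A) .tru) :=
  eq_tru (fls_imp A)

theorem fls_and (A : Term N K Γ Ty.t) : Prov H (.eq (.and .fls A) .fls) :=
  symm (fls_imp A)

theorem fls_elim (h : Prov H .fls) (A : Term N K Γ Ty.t) : Prov H A :=
  mp (fls_imp A) h

theorem imp_of {A B : Term N K Γ Ty.t} (h : Prov H B) : Prov H (A.imp B) := by
  simpa [Term.inst] using cases (H := H) (.imp .v0 (B.shift _))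
    (by simpa [Term.inst] using mpEq' (tru_imp B) h) (by simpa [Term.inst] using fls_imp B) A

theorem imp_self (A : Term N K Γ Ty.t) : Prov H (A.imp A) := by
  simpa [Term.inst] using cases (H := H) (.imp .v0 .v0)
    (by simpa [Term.inst] using imp_of tru) (by simpa [Term.inst] using fls_imp _) A

/-! ### The deduction theorem -/

theorem imp_mp {φ A B : Term N K Γ Ty.t} (h : Prov H (φ.imp (A.imp B)))
    (hA : Prov H (φ.imp A)) : Prov H (φ.imp B) := by
  have key : Prov H (.imp (φ.imp (A.imp B)) (.imp (φ.imp A) (φ.imp B))) := by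
    simpa [Term.inst] using cases (H := H)
      (.imp (.imp .v0 (.imp (A.shift _) (B.shift _)))
        (.imp (.imp .v0 (A.shift _)) (.imp .v0 (B.shift _))))
      (by simpa [Term.inst] using
        mpEq' (congImp (tru_imp _) (congImp (tru_imp _) (tru_imp _))) (imp_self _))
      (by simpa [Term.inst] using imp_of (imp_of (fls_imp B))) φ
  exact mp (mp key h) hA

theorem imp_of_eq (A B : Term N K Γ Ty.t) : Prov H (.imp (.eq A B) (.imp A B)) := by
  simpa [Term.inst] using cases (H := H) (.imp (.eq .v0 (B.shift _)) (.imp .v0 (B.shift _)))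
    (by simpa [Term.inst] using mpEq' (congImp (tru_eq B) (tru_imp B)) (imp_self B))
    (by simpa [Term.inst] using imp_of (fls_imp B)) A

theorem imp_mpEq {φ A B : Term N K Γ Ty.t} (h : Prov H (φ.imp (.eq A B)))
    (hA : Prov H (φ.imp A)) : Prov H (φ.imp B) :=
  imp_mp (imp_mp (imp_of (imp_of_eq A B)) h) hA

theorem imp_congInst {φ : Term N K Γ Ty.t} {A B : Term N K Γ α}
    (h : Prov H (φ.imp (.eq A B))) (C : Term N K (α :: Γ) β) :
    Prov H (φ.imp (.eq (C.inst A) (C.inst B))) := by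
  -- Leibniz' axiom concerns formulas only, so it is applied to the property `C(A) = C(x)`, which
  -- makes sense for `C` of any type.
  have hC := leibniz_inst (H := H) (.eq ((C.inst A).shift α) C) A B
  have hA : (Term.eq ((C.inst A).shift α) C).inst A = .eq (C.inst A) (C.inst A) := by
    simp [Term.inst]
  have hB : (Term.eq ((C.inst A).shift α) C).inst B = .eq (C.inst A) (C.inst B) := by
    simp [Term.inst]
  rw [hA, hB] at hC
  exact imp_mpEq (imp_mp (imp_of hC) h) (imp_of (refl _))

theorem imp_eq_trans {φ : Term N K Γ Ty.t} {A B C : Term N K Γ α}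
    (h : Prov H (φ.imp (.eq A B))) (h' : Prov H (φ.imp (.eq B C))) :
    Prov H (φ.imp (.eq A C)) := by
  have := imp_congInst h' (.eq (A.shift _) .v0)
  simp only [Term.inst, Term.subst, Term.shift_subst_single, Sub.single_zero] at this
  exact imp_mpEq this h

/-- By cases on `φ`, which does not contain the bound variable: `φ → ∀A` and `∀(φ → A)` both reduce
to `∀A` or both are true. -/
theorem imp_all {φ : Term N K Γ Ty.t} {A : Term N K (α :: Γ) Ty.t}
    (h : Prov (Term.shift α '' H) ((φ.shift α).imp A)) : Prov H (φ.imp A.all) := by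
  have key : Prov H (.eq (φ.imp A.all) (Term.all ((φ.shift α).imp A))) := by
    simpa [Term.inst] using cases_eq (H := H)
      (.imp .v0 (.all (A.rename (Ren.lift (fun _ x => Var.succ x) α))))
      (.all (.imp .v1 (A.rename (Ren.lift (fun _ x => Var.succ x) α))))
      (by simpa [Term.inst] using (tru_imp _).trans (congAll (tru_imp A).symm))
      (by simpa [Term.inst] using
        (fls_imp_eq _).trans (eq_tru (all_intro (fls_imp A))).symm) φ
  exact mpEq' key (all_intro h)

/-- The deduction theorem. -/
theorem deduction {φ A : Term N K Γ Ty.t} (h : Prov (insert φ H) A) : Prov H (φ.imp A) := by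
  generalize hG : insert φ H = G at h
  induction h with
  | hyp h =>
    subst hG
    rcases h with rfl | h
    · exact imp_self _
    · exact imp_of (hyp h)
  | mpEq _ _ ih₁ ih₂ => exact imp_mpEq (ih₁ hG) (ih₂ hG)
  | refl A => exact imp_of (refl A)
  | @congApp _ _ _ _ A A' B B' _ _ ih₁ ih₂ =>
    have h₁ := imp_congInst (ih₁ hG) (.app .v0 (B.shift _))
    have h₂ := imp_congInst (ih₂ hG) (.app (A'.shift _) .v0)
    simp only [Term.inst, Term.subst, Term.shift_subst_single, Sub.single_zero] at h₁ h₂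
    exact imp_eq_trans h₁ h₂
  | congLam _ ih =>
    -- The new variable is fresh for `φ`, so the implication passes through the quantifier.
    -- Extensionality then restores the abstractions.
    exact imp_mpEq (imp_of (ext_lam _ _).symm) (imp_all (ih (by rw [← hG, Set.image_insert_eq])))
  | @congEq _ _ _ A A' B B' _ _ ih₁ ih₂ =>
    have h₁ := imp_congInst (ih₁ hG) (.eq .v0 (B.shift _))
    have h₂ := imp_congInst (ih₂ hG) (.eq (A'.shift _) .v0)
    simp only [Term.inst, Term.subst, Term.shift_subst_single, Sub.single_zero] at h₁ h₂
    exact imp_eq_trans h₁ h₂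
  | @congPair _ _ _ _ A A' B B' _ _ ih₁ ih₂ =>
    have h₁ := imp_congInst (ih₁ hG) (.pair .v0 (B.shift _))
    have h₂ := imp_congInst (ih₂ hG) (.pair (A'.shift _) .v0)
    simp only [Term.inst, Term.subst, Term.shift_subst_single, Sub.single_zero] at h₁ h₂
    exact imp_eq_trans h₁ h₂
  | congFst _ ih => exact imp_congInst (ih hG) (.fst .v0)
  | congSnd _ ih => exact imp_congInst (ih hG) (.snd .v0)
  | bool G => exact imp_of (bool G)
  | leibniz A B P => exact imp_of (leibniz A B P)
  | ext F G => exact imp_of (ext F G)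
  | beta A B => exact imp_of (beta A B)
  | descr A => exact imp_of (descr A)
  | fstPair A B => exact imp_of (fstPair A B)
  | sndPair A B => exact imp_of (sndPair A B)
  | pairEta A => exact imp_of (pairEta A)
  | unit => exact imp_of unit
  | assoc => exact imp_of assoc
  | letter i j hij => exact imp_of (letter i j hij)

/-! ### Natural deduction -/

theorem and_tru (A : Term N K Γ Ty.t) : Prov H (.eq (.and A .tru) A) := by
  simpa [Term.inst] using cases_eq (H := H) (.and .v0 .tru) .v0
    (by simpa [Term.inst] using tru_and _) (by simpa [Term.inst] using fls_and _) A

/-- Implication is defined by `A = (A ∧ B)`, so the two deductions are joined by commutativity of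
conjunction, proved by cases. -/
theorem prop_ext {A B : Term N K Γ Ty.t} (h : Prov (insert A H) B) (h' : Prov (insert B H) A) :
    Prov H (.eq A B) := by
  have key : Prov H (.eq (.and A B) (.and B A)) := by
    simpa [Term.inst] using cases_eq (H := H) (.and .v0 (B.shift _)) (.and (B.shift _) .v0)
      (by simpa [Term.inst] using (tru_and B).trans (and_tru B).symm)
      (by
        have := cases_eq (H := H) .fls (.and .v0 .fls)
          (by simpa [Term.inst] using tru_and_fls.symm)
          (by simpa [Term.inst] using (fls_and _).symm) B
        simp only [Term.inst, Term.subst, Term.subst_and, Term.subst_fls,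
          Sub.single_zero] at this
        simpa [Term.inst] using (fls_and B).trans this) A
  exact (deduction h).trans (key.trans (symm (deduction h')))

theorem not_fls : Prov H (.not .fls) := refl _

theorem not_elim {A : Term N K Γ Ty.t} (h : Prov H A.not) (hA : Prov H A) : Prov H .fls :=
  mpEq' h hA

theorem not_intro {A : Term N K Γ Ty.t} (h : Prov (insert A H) .fls) : Prov H A.not :=
  prop_ext (fls_elim (hyp (Set.mem_insert _ _)) A) h

theorem not_tru : Prov H (.eq (.not .tru) .fls) :=
  prop_ext (not_elim (hyp (Set.mem_insert _ _)) tru) (fls_elim (hyp (Set.mem_insert _ _)) _)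

theorem not_fls_eq : Prov H (.eq (.not .fls) .tru) := eq_tru not_fls

theorem not_not (A : Term N K Γ Ty.t) : Prov H (.eq A.not.not A) := by
  simpa [Term.inst] using cases_eq (H := H) (.not (.not .v0)) .v0
    (by simpa [Term.inst] using (congNot not_tru).trans not_fls_eq)
    (by simpa [Term.inst] using (congNot not_fls_eq).trans not_tru) A

theorem by_contra {A : Term N K Γ Ty.t} (h : Prov (insert A.not H) .fls) : Prov H A :=
  mpEq (not_not A) (not_intro h)

theorem and_self (A : Term N K Γ Ty.t) : Prov H (.eq (.and A A) A) :=
  symm (imp_self A)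

theorem or_self (A : Term N K Γ Ty.t) : Prov H (.eq (.or A A) A) :=
  (congNot (and_self _)).trans (not_not A)

theorem fls_or (A : Term N K Γ Ty.t) : Prov H (.eq (.or .fls A) A) :=
  (congNot ((congAnd not_fls_eq (refl _)).trans (tru_and _))).trans (not_not A)

theorem or_of_left {A : Term N K Γ Ty.t} (h : Prov H A) (B : Term N K Γ Ty.t) :
    Prov H (.or A B) :=
  mpEq' (congNot ((congAnd ((congNot (eq_tru h)).trans not_tru) (refl _)).trans (fls_and _)))
    not_fls

theorem and_fls (A : Term N K Γ Ty.t) : Prov H (.eq (.and A .fls) .fls) := by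
  simpa [Term.inst] using cases_eq (H := H) (.and .v0 .fls) .fls
    (by simpa [Term.inst] using tru_and_fls) (by simpa [Term.inst] using fls_and _) A

theorem or_of_right (A : Term N K Γ Ty.t) {B : Term N K Γ Ty.t} (h : Prov H B) :
    Prov H (.or A B) :=
  mpEq' (congNot ((congAnd (refl _) ((congNot (eq_tru h)).trans not_tru)).trans (and_fls _)))
    not_fls

theorem ex_intro {A : Term N K (α :: Γ) Ty.t} (B : Term N K Γ α) (h : Prov H (A.inst B)) :
    Prov H A.ex :=
  not_intro (not_elim (all_elim (hyp (Set.mem_insert _ _)) B)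
    (h.mono (Set.subset_insert _ _)))

theorem ex_elim {A : Term N K (α :: Γ) Ty.t} {C : Term N K Γ Ty.t} (h : Prov H A.ex)
    (hC : Prov (insert A (Term.shift α '' H)) (C.shift α)) : Prov H C := by
  -- The existential is `¬∀¬`: assuming `¬C`, each instance of `A` is refuted, which contradicts it.
  refine by_contra (not_elim (h.mono (Set.subset_insert _ _)) (all_intro (not_intro ?_)))
  rw [Set.image_insert_eq]
  exact not_elim (A := C.shift α) (hyp (by simp))
    (hC.mono (Set.insert_subset_insert (Set.subset_insert _ _)))

/-! ### Descriptions -/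

theorem eq_comm (A B : Term N K Γ α) : Prov H (.eq (.eq A B) (.eq B A)) :=
  prop_ext (symm (hyp (Set.mem_insert _ _))) (symm (hyp (Set.mem_insert _ _)))

theorem eqTo_app (A B : Term N K Γ α) : Prov H (.eq (.app A.eqTo B) (.eq B A)) :=
  beta' _ _ (by simp [Term.inst])

/-- The first component of description at a product type, applied to `(= A)`. Surjective pairing
makes the second projection the witness. -/
theorem ex_eq_pair_right (B : Term N K Γ α) (A : Term N K Γ (.prod α β)) :
    Prov H (.eq (.ex (.eq (.pair (B.shift β) .v0) (A.shift β))) (.eq B (.fst A))) := by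
  refine prop_ext (ex_elim (hyp (Set.mem_insert _ _)) ?_) (ex_intro (.snd A) ?_)
  · exact (fstPair _ .v0).symm.trans (congFst (hyp (Set.mem_insert _ _)))
  · have : Prov (insert (.eq B (.fst A)) H) (.eq (.pair B (.snd A)) A) :=
      (congPair (hyp (Set.mem_insert _ _)) (refl _)).trans (pairEta A)
    simpa [Term.inst] using this

theorem ex_eq_pair_left (B : Term N K Γ β) (A : Term N K Γ (.prod α β)) :
    Prov H (.eq (.ex (.eq (.pair .v0 (B.shift α)) (A.shift α))) (.eq B (.snd A))) := by
  refine prop_ext (ex_elim (hyp (Set.mem_insert _ _)) ?_) (ex_intro (.fst A) ?_)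
  · exact (sndPair .v0 _).symm.trans (congSnd (hyp (Set.mem_insert _ _)))
  · have : Prov (insert (.eq B (.snd A)) H) (.eq (.pair (.fst A) B) A) :=
      (congPair (refl _) (hyp (Set.mem_insert _ _))).trans (pairEta A)
    simpa [Term.inst] using this

/-- The description axiom has `A = x` where `eqTo` has `x = A`, so the sides are exchanged under the
abstraction. -/
theorem iota_eqTo (A : Term N K Γ α) : Prov H (.eq (.app (.iota α) A.eqTo) A) :=
  (congApp (refl _) (congLam (eq_comm _ _))).trans (descr A)

theorem shift_eqTo (A : Term N K Γ α) (β : Ty n) : A.eqTo.shift β = (A.shift β).eqTo := by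
  simp only [Term.shift, Term.rename_eq_subst, Term.subst_eqTo]

/-- Every description operator sends `λx (x = A)` to `A`. -/
theorem desc_eqTo {Γ : List (Ty n)} {H : Set (Term N K Γ Ty.t)} {α : Ty n}
    (A : Term N K Γ α) : Prov H (.eq (.app (.desc α) A.eqTo) A) := by
  induction α generalizing Γ with
  | t => exact iota_eqTo A
  | ind i => exact iota_eqTo A
  | fn α β => exact iota_eqTo A
  | prod α β ihα ihβ =>
    -- The predicates passed to the two recursive descriptions are again singletons, those of the
    -- projections of `A`.
    have h₁ : Prov H (.eq (.lam (.ex (.app (((A.eqTo).shift α).shift β) (.pair .v1 .v0))))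
        (Term.fst A).eqTo) :=
      congLam ((congEx (by rw [shift_eqTo, shift_eqTo]; exact eqTo_app _ _)).trans
        (ex_eq_pair_right .v0 (A.shift α)))
    have h₂ : Prov H (.eq (.lam (.ex (.app (((A.eqTo).shift β).shift α) (.pair .v0 .v1))))
        (Term.snd A).eqTo) :=
      congLam ((congEx (by rw [shift_eqTo, shift_eqTo]; exact eqTo_app _ _)).trans
        (ex_eq_pair_left .v0 (A.shift β)))
    exact (beta' _ _ (by simp [Term.inst])).trans
      ((congPair ((congApp (refl _) h₁).trans (ihα _))
        ((congApp (refl _) h₂).trans (ihβ _))).trans (pairEta A))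

/-! ### Disjunctions of predicates and self-extensions -/

theorem orPred_app (P Q : Term N K Γ (α ⇒ Ty.t)) (A : Term N K Γ α) :
    Prov H (.eq (.app (P.orPred Q) A) (.or (.app P A) (.app Q A))) :=
  beta' _ _ (by simp [Term.inst])

theorem eta (P : Term N K Γ (α ⇒ β)) : Prov H (.eq (.lam (.app (P.shift α) .v0)) P) :=
  mpEq' (ext _ P) (all_intro (beta' _ _ (by simp [Term.inst])))

theorem orPred_self (P : Term N K Γ (α ⇒ Ty.t)) : Prov H (.eq (P.orPred P) P) :=
  (congLam (or_self _)).trans (eta P)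

theorem fls_orPred (P : Term N K Γ (α ⇒ Ty.t)) :
    Prov H (.eq ((Term.lam .fls).orPred P) P) :=
  (congLam ((congOr (beta' _ _ rfl) (refl _)).trans (fls_or _))).trans (eta P)

theorem bigOr_app_of_mem {l : List (Term N K Γ (α ⇒ Ty.t))} {P : Term N K Γ (α ⇒ Ty.t)}
    (hP : P ∈ l) {A : Term N K Γ α} (h : Prov H (.app P A)) :
    Prov H (.app (.bigOr l) A) := by
  induction l using Term.bigOr.induct with
  | case1 => simp at hP
  | case2 Q =>
    obtain rfl : P = Q := by simpa using hP
    exact h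
  | case3 Q R l ih =>
    rcases List.mem_cons.1 hP with rfl | hP
    · exact mpEq' (orPred_app _ _ _) (or_of_left h _)
    · exact mpEq' (orPred_app _ _ _) (or_of_right _ (ih hP))

/-- Idempotence of disjunction. The empty list must be excluded, since its disjunction is `λx F`. -/
theorem bigOr_eq {l : List (Term N K Γ (α ⇒ Ty.t))} (hl : l ≠ []) {P : Term N K Γ (α ⇒ Ty.t)}
    (h : ∀ Q ∈ l, Prov H (.eq Q P)) : Prov H (.eq (.bigOr l) P) := by
  induction l using Term.bigOr.induct with
  | case1 => exact absurd rfl hl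
  | case2 Q => exact h Q (by simp)
  | case3 Q R l ih =>
    exact (congOrPred (h Q (by simp))
      (ih (by simp) fun S hS => h S (List.mem_cons_of_mem _ hS))).trans (orPred_self P)

theorem trans_app (L : Term N K Γ (Ty.sym ⇒ α ⇒ Ty.t)) (W : Term N K Γ Ty.sym) :
    Prov H (.eq (.app (.app (.trans α) L) W) (.app (.desc α) (.app L W))) :=
  (congApp (beta _ _) (refl _)).trans (beta' _ _ (by simp [Term.inst]))

theorem selfExt_app (L : Term N K Γ (Ty.sym ⇒ α ⇒ Ty.t)) (W : Term N K Γ Ty.sym) :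
    Prov H (.eq (.app L.selfExt W)
      ((Term.app L W).orPred (Term.app (.app (.trans α) L) W).eqTo)) :=
  (beta _ _).trans (by
    have h : Prov H (.eq (.app (.lam (.eqTo (.app (.app (.trans α) (L.shift _)) .v0))) W)
        (Term.app (.app (.trans α) L) W).eqTo) := beta' _ _ (by simp [Term.inst])
    simpa [Term.inst] using congOrPred (refl (Term.app L W)) h)

end Prov

end UHOG

/-! ### Translation under the self-extension -/

theorem proposition10p1 {n : ℕ} [NeZero n] {N : ℕ} {K : Ty n → Type*} {K' : Ty n → Type*}
    {α : Ty n} (Δ : Set (Term N (Plus K K') [] Ty.t))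
    (L : Term N (Plus K K') [] (Ty.sym ⇒ α ⇒ Ty.t)) (𝓛 : Lang N K α)
    (hL : PseudoCanonic Δ L 𝓛) (w : List (Fin N))
    (hw : (𝓛.Valid w ∧ ¬ 𝓛.Ambiguous K' w) ∨ ¬ 𝓛.Valid w) :
    Prov Δ (.eq (.app (.app (Term.trans α) L.selfExt) (.word w))
      (.app (.app (Term.trans α) L) (.word w))) := by
  obtain ⟨As, hAs⟩ := hL.finite w
  -- The disjunct `(= A)` holds of `A` by reflexivity, so `Δ` proves `L /w/ A`, and representation
  -- gives membership.
  have hmem : ∀ A ∈ As, (w, A) ∈ 𝓛 := fun A hA =>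
    (hL.represents.mem_iff w A).2 (.mpEq' (.congApp hAs (.refl _))
      (.bigOr_app_of_mem (List.mem_map_of_mem hA) (.mpEq' (.eqTo_app _ _) (.refl _))))
  have hext : Prov Δ (.eq (.app (.app (Term.trans α) L.selfExt) (.word w))
      (.app (.desc α) ((Term.app L (.word w)).orPred
        (Term.app (.app (.trans α) L) (.word w)).eqTo))) :=
    (Prov.trans_app _ _).trans (.congApp (.refl _) (.selfExt_app _ _))
  refine hext.trans ?_
  cases As with
  | nil =>
    -- `L /w/` is `λx F`, so the extended predicate is exactly `(= τ L /w/)`.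
    exact (Prov.congApp (.refl _) ((Prov.congOrPred hAs (.refl _)).trans (.fls_orPred _))).trans
      (.desc_eqTo _)
  | cons A As =>
    have hw : ¬ 𝓛.Ambiguous K' w := by
      rcases hw with hw | hw
      · exact hw.2
      · exact absurd ⟨A, hmem A (by simp)⟩ hw
    have hA : Prov Δ (.eq (.app L (.word w)) (A.incl K').eqTo) := by
      refine hAs.trans (.bigOr_eq (by simp) fun Q hQ => ?_)
      obtain ⟨B, hB, rfl⟩ := List.mem_map.1 hQ
      -- Non-ambiguity gives equality of meanings without hypotheses, which persists in `Δ`.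
      refine .congEqTo (Prov.mono (H := ∅) ?_ (Set.empty_subset _))
      by_contra h
      exact hw ⟨B, A, hmem B hB, hmem A (by simp), h⟩
    have hτ : Prov Δ (.eq (.app (.app (.trans α) L) (.word w)) (A.incl K')) :=
      (Prov.trans_app _ _).trans ((Prov.congApp (.refl _) hA).trans (.desc_eqTo _))
    -- Both disjuncts are now `(= A)`, so the description is `A`, which is also `τ L /w/`.
    exact (Prov.congApp (.refl _) ((Prov.congOrPred hA (.congEqTo hτ)).trans
      (.orPred_self _))).trans ((Prov.desc_eqTo _).trans hτ.symm)
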